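/- Let $t, m, n \ge 1$ be integers and let $G = G(\mathbb{C})$ be one of the groups $\mathrm{GL}_t(\mathbb{C})$, $\mathrm{SL}_t(\mathbb{C})$, $\mathrm{O}_t(\mathbb{C}) = \{M : M^{\mathrm{tr}} M = I_t\}$, or, if $t = 2s$ is even, $\mathrm{Sp}_t(\mathbb{C}) = \{M : M^{\mathrm{tr}} \Omega M = \Omega\}$ with $\Omega = \begin{pmatrix} 0 & I_s \\ -I_s & 0 \end{pmatrix}$. Let $C = G \cap \mathrm{U}_t(\mathbb{C})$, a compact group in the Euclidean topology, and let $dC$ be its normalised Haar measure. Let $\mathbb{C}[Z]$ be either the polynomial ring $\mathbb{C}[Y]$ in the entries of a $t \times n$ matrix $Y$ of indeterminates, where $M \in G$ acts by the $\mathbb{C}$-algebra automorphism $Y \mapsto MY$, or the polynomial ring $\mathbb{C}[X, Y]$ in the entries of an $m \times t$ matrix $X$ and a $t \times n$ matrix $Y$ of indeterminates, where $M \in G$ acts by the $\mathbb{C}$-algebra automorphism $X \mapsto X M^{-1}$, $Y \mapsto M Y$. Write $\mathbb{C}[Z]^H$ for the subalgebra of polynomials fixed by every element of $H$. For $f \in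 \mathbb{C}[Z]$ put $$\mathcal{R}(f) = \int_{g \in C} g(f) \, dC,$$ where the function $g \mapsto g(f)$, whose values span a finite-dimensional space, is integrated coordinatewise in a basis of that space. Then $\mathbb{C}[Z]^{G} = \mathbb{C}[Z]^{C}$, and $\mathcal{R}$ is the Reynolds operator for the action of $G$ on $\mathbb{C}[Z]$. That is, $\mathcal{R}$ is a $\mathbb{C}$-linear map $\mathbb{C}[Z] \to \mathbb{C}[Z]^{G}$ with $\mathcal{R}(f) = f$ for all $f \in \mathbb{C}[Z]^{G}$ and $\mathcal{R}(g(f)) = \mathcal{R}(f)$ for all $g \in G$ and $f \in \mathbb{C}[Z]$, and it is the only $\mathbb{C}$-linear map $\mathbb{C}[Z] \to \mathbb{C}[Z]^{G}$ with these two properties. -/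

import Mathlib

open MeasureTheory
open scoped Matrix MatrixGroups

namespace ClassicalInvariants

section Groups

variable {t : ℕ} {k : Type*} [Field k]

/-- The group of invertible matrices `M` with `Mᵀ B M = B`, for a fixed matrix `B`. -/
def formGroup (B : Matrix (Fin t) (Fin t) k) : Subgroup (GL (Fin t) k) where
  carrier := {M | (M : Matrix (Fin t) (Fin t) k)ᵀ * B * (M : Matrix (Fin t) (Fin t) k) = B}
  one_mem' := by simp
  mul_mem' := by
    intro M N hM hN
    simp only [Set.mem_ofPred_eq] at hM hN ⊢
    rw [Units.val_mul, Matrix.transpose_mul]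
    calc _ = (N : Matrix (Fin t) (Fin t) k)ᵀ * ((M : Matrix (Fin t) (Fin t) k)ᵀ * B *
            (M : Matrix (Fin t) (Fin t) k)) * (N : Matrix (Fin t) (Fin t) k) := by
          simp only [Matrix.mul_assoc]
      _ = B := by rw [hM, hN]
  inv_mem' := by
    intro M hM
    simp only [Set.mem_ofPred_eq] at hM ⊢
    have h1 : (M : Matrix (Fin t) (Fin t) k) * (M⁻¹ : GL (Fin t) k).val = 1 := Units.mul_inv M
    have h2 : (M⁻¹ : GL (Fin t) k).valᵀ * (M : Matrix (Fin t) (Fin t) k)ᵀ = 1 := by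
      rw [← Matrix.transpose_mul, h1, Matrix.transpose_one]
    calc (M⁻¹ : GL (Fin t) k).valᵀ * B * (M⁻¹ : GL (Fin t) k).val
        = (M⁻¹ : GL (Fin t) k).valᵀ * ((M : Matrix (Fin t) (Fin t) k)ᵀ * B *
            (M : Matrix (Fin t) (Fin t) k)) * (M⁻¹ : GL (Fin t) k).val := by rw [hM]
      _ = ((M⁻¹ : GL (Fin t) k).valᵀ * (M : Matrix (Fin t) (Fin t) k)ᵀ) * B *
            ((M : Matrix (Fin t) (Fin t) k) * (M⁻¹ : GL (Fin t) k).val) := by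
          simp only [Matrix.mul_assoc]
      _ = B := by rw [h1, h2, Matrix.one_mul, Matrix.mul_one]

variable (t k)

/-- For even `t = 2 s`, the block matrix with rows `(0, I_s)` and `(-I_s, 0)`. -/
def omega : Matrix (Fin t) (Fin t) k :=
  Matrix.of fun i j =>
    if (j : ℕ) = i + t / 2 then 1 else if (i : ℕ) = j + t / 2 then -1 else 0

/-- The four families of classical groups. -/
inductive Family
  | general
  | special
  | orthogonal
  | symplectic

variable {t}

/-- The classical group of `t × t` matrices over `k` of the given family
(in the symplectic case this is meant for even `t`). -/
def Family.group (F : Family) (t : ℕ) (k : Type*) [Field k] : Subgroup (GL (Fin t) k) :=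
  match F with
  | .general => ⊤
  | .special => (Matrix.GeneralLinearGroup.det : GL (Fin t) k →* kˣ).ker
  | .orthogonal => formGroup 1
  | .symplectic => formGroup (omega t k)

/-- The unitary group `U_t(ℂ)` as a subgroup of `GL_t(ℂ)`. -/
def unitarySubgroup (t : ℕ) : Subgroup (GL (Fin t) ℂ) where
  carrier := {M | (M : Matrix (Fin t) (Fin t) ℂ) ∈ Matrix.unitaryGroup (Fin t) ℂ}
  one_mem' := (Matrix.unitaryGroup (Fin t) ℂ).one_mem
  mul_mem' := fun hM hN => (Matrix.unitaryGroup (Fin t) ℂ).mul_mem hM hN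
  inv_mem' := by
    intro M hM
    have h : (M⁻¹ : GL (Fin t) ℂ).val = star (M : Matrix (Fin t) (Fin t) ℂ) := by
      apply Units.inv_eq_of_mul_eq_one_right
      exact Matrix.mem_unitaryGroup_iff.1 hM
    change (M⁻¹ : GL (Fin t) ℂ).val ∈ Matrix.unitaryGroup (Fin t) ℂ
    rw [h]
    exact Unitary.star_mem hM

/-- The group `C`, the intersection of the classical group over `ℂ` with the unitary group;
its topology is the Euclidean one, inherited from `GL_t(ℂ)`. -/
noncomputable def Family.compactGroup (F : Family) (t : ℕ) : Subgroup (GL (Fin t) ℂ) :=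
  F.group t ℂ ⊓ unitarySubgroup t

theorem isCompact_unitarySubgroup (t : ℕ) :
    IsCompact (unitarySubgroup t : Set (GL (Fin t) ℂ)) := by
  have hU : IsCompact (Matrix.unitaryGroup (Fin t) ℂ : Set (Matrix (Fin t) (Fin t) ℂ)) := by
    have hK : IsCompact (Set.univ.pi fun _ : Fin t => Set.univ.pi fun _ : Fin t =>
        Metric.closedBall (0 : ℂ) 1) :=
      isCompact_univ_pi fun _ => isCompact_univ_pi fun _ => isCompact_closedBall 0 1
    have hcl : IsClosed {A : Matrix (Fin t) (Fin t) ℂ | A * star A = 1} :=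
      isClosed_eq (by fun_prop) continuous_const
    refine IsCompact.of_isClosed_subset hK ?_ ?_
    · convert hcl using 1
      ext A
      exact Matrix.mem_unitaryGroup_iff
    · intro A hA i _ j _
      rw [mem_closedBall_zero_iff]
      exact entry_norm_bound_of_unitary hA i j
  have : CompactSpace (Matrix.unitaryGroup (Fin t) ℂ) := isCompact_iff_compactSpace.1 hU
  let φ : Matrix.unitaryGroup (Fin t) ℂ → GL (Fin t) ℂ := fun u =>
    ⟨u.1, star u.1, Matrix.mem_unitaryGroup_iff.1 u.2, Matrix.mem_unitaryGroup_iff'.1 u.2⟩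
  have hφ : Continuous φ :=
    Units.continuous_iff.2 ⟨continuous_subtype_val, continuous_subtype_val.star⟩
  have himg : (unitarySubgroup t : Set (GL (Fin t) ℂ)) = Set.range φ := by
    ext M
    constructor
    · intro hM
      have hM' : (M : Matrix (Fin t) (Fin t) ℂ) ∈ Matrix.unitaryGroup (Fin t) ℂ := hM
      exact ⟨⟨M.1, hM'⟩, Units.ext rfl⟩
    · rintro ⟨u, rfl⟩
      change (φ u).val ∈ Matrix.unitaryGroup (Fin t) ℂ
      exact u.2
  rw [himg]
  exact isCompact_range hφ

theorem isClosed_formGroup (B : Matrix (Fin t) (Fin t) ℂ) :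
    IsClosed (formGroup B : Set (GL (Fin t) ℂ)) := by
  have h : Continuous fun M : GL (Fin t) ℂ => (M : Matrix (Fin t) (Fin t) ℂ) :=
    Units.continuous_val
  exact isClosed_eq ((h.matrix_transpose.matrix_mul continuous_const).matrix_mul h)
    continuous_const

theorem Family.isClosed_group (F : Family) (t : ℕ) :
    IsClosed (F.group t ℂ : Set (GL (Fin t) ℂ)) := by
  cases F with
  | general => exact isClosed_univ
  | special =>
    have h : Continuous fun M : GL (Fin t) ℂ => (M : Matrix (Fin t) (Fin t) ℂ) :=
      Units.continuous_val
    have hcl : IsClosed {M : GL (Fin t) ℂ | (M : Matrix (Fin t) (Fin t) ℂ).det = 1} :=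
      isClosed_eq h.matrix_det continuous_const
    convert hcl using 1
    ext M
    simp [Family.group, MonoidHom.mem_ker, Units.ext_iff]
  | orthogonal => exact isClosed_formGroup _
  | symplectic => exact isClosed_formGroup _

instance (F : Family) (t : ℕ) : CompactSpace (F.compactGroup t) :=
  isCompact_iff_compactSpace.1
    ((isCompact_unitarySubgroup t).inter_left (F.isClosed_group t))

end Groups

section Integration

variable {K : Type*} [Group K] [TopologicalSpace K] [IsTopologicalGroup K] [CompactSpace K]

/-- The integral of a real-valued function on a compact group against the Haar measure,
normalised so that the whole group has measure `1`. -/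
noncomputable def haarIntegral (φ : K → ℝ) : ℝ :=
  letI : MeasurableSpace K := borel K
  haveI : BorelSpace K := ⟨rfl⟩
  ∫ g, φ g ∂(Measure.haarMeasure (⊤ : TopologicalSpace.PositiveCompacts K))

/-- The integral of a function on a compact group with values in a real vector space, where
the span `W` of its values is finite-dimensional: the coordinate functions in a basis of `W`
are integrated one by one. -/
noncomputable def vectorIntegral {V : Type*} [AddCommGroup V] [Module ℝ V] (Ψ : K → V) : V :=
  let b := Module.Free.chooseBasis ℝ (Submodule.span ℝ (Set.range Ψ))
  ∑ᶠ i, haarIntegral (fun g => b.repr ⟨Ψ g, Submodule.subset_span ⟨g, rfl⟩⟩ i) • (b i : V)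

end Integration

section Actions

variable {k : Type*} [Field k] {t : ℕ} {σ : Type*}

/-- The variables of `k[Y]`, with `Y` of size `t × n`. -/
abbrev StdVars (t n : ℕ) : Type := Fin t × Fin n

/-- The variables of `k[X, Y]`, with `X` of size `m × t` and `Y` of size `t × n`. -/
abbrev StdDualVars (m t n : ℕ) : Type := (Fin m × Fin t) ⊕ (Fin t × Fin n)

/-- `M ∈ GL_t(k)` acts on `k[Y]` by the `k`-algebra map `Y ↦ M Y`,
that is, `y_ij` is sent to the `(i, j)` entry of `M Y`. -/
noncomputable def stdAction (n : ℕ) (M : GL (Fin t) k) :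
    MvPolynomial (StdVars t n) k →ₐ[k] MvPolynomial (StdVars t n) k :=
  MvPolynomial.aeval fun p =>
    ∑ l : Fin t, MvPolynomial.C ((M : Matrix (Fin t) (Fin t) k) p.1 l) * MvPolynomial.X (l, p.2)

/-- `M ∈ GL_t(k)` acts on `k[X, Y]` by the `k`-algebra map `X ↦ X M⁻¹`, `Y ↦ M Y`. -/
noncomputable def stdDualAction (m n : ℕ) (M : GL (Fin t) k) :
    MvPolynomial (StdDualVars m t n) k →ₐ[k] MvPolynomial (StdDualVars m t n) k :=
  MvPolynomial.aeval (Sum.elim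
    (fun p => ∑ l : Fin t, MvPolynomial.X (Sum.inl (p.1, l)) *
      MvPolynomial.C ((M⁻¹ : GL (Fin t) k).val l p.2))
    (fun p => ∑ l : Fin t, MvPolynomial.C ((M : Matrix (Fin t) (Fin t) k) p.1 l) *
      MvPolynomial.X (Sum.inr (l, p.2))))

/-- The subalgebra of polynomials fixed by all `ρ g` with `g ∈ G`. -/
def invariants (ρ : GL (Fin t) k → MvPolynomial σ k →ₐ[k] MvPolynomial σ k)
    (G : Subgroup (GL (Fin t) k)) : Subalgebra k (MvPolynomial σ k) where
  carrier := {f | ∀ g ∈ G, ρ g f = f}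
  mul_mem' := fun ha hb g hg => by rw [map_mul, ha g hg, hb g hg]
  add_mem' := fun ha hb g hg => by rw [map_add, ha g hg, hb g hg]
  algebraMap_mem' := fun r g _ => (ρ g).commutes r

/-- A Reynolds operator: a `k`-linear map onto the invariants that restricts to the identity
on invariants and takes the same value on `f` and `g(f)` for every `g ∈ G`. -/
structure IsReynoldsOperator (ρ : GL (Fin t) k → MvPolynomial σ k →ₐ[k] MvPolynomial σ k)
    (G : Subgroup (GL (Fin t) k)) (R : MvPolynomial σ k →ₗ[k] invariants ρ G) : Prop where
  splits : ∀ f : invariants ρ G, R (f : MvPolynomial σ k) = f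
  equivariant : ∀ g ∈ G, ∀ f : MvPolynomial σ k, R (ρ g f) = R f

/-- The average `∫_{g ∈ C} g(f)` of `f` over a compact group `C` of complex matrices. -/
noncomputable def haarAverage
    (ρ : GL (Fin t) ℂ → MvPolynomial σ ℂ →ₐ[ℂ] MvPolynomial σ ℂ)
    (C : Subgroup (GL (Fin t) ℂ)) [CompactSpace C] (f : MvPolynomial σ ℂ) :
    MvPolynomial σ ℂ :=
  vectorIntegral fun g : C => ρ (g : GL (Fin t) ℂ) f

/-- The invariants of `G` and of `C` agree, and averaging over `C` is the (unique) Reynolds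
operator for the action of `G`. -/
def HaarAverageIsReynolds
    (ρ : GL (Fin t) ℂ → MvPolynomial σ ℂ →ₐ[ℂ] MvPolynomial σ ℂ)
    (G C : Subgroup (GL (Fin t) ℂ)) [CompactSpace C] : Prop :=
  invariants ρ G = invariants ρ C ∧
    ∃ R : MvPolynomial σ ℂ →ₗ[ℂ] invariants ρ G,
      (∀ f, (R f : MvPolynomial σ ℂ) = haarAverage ρ C f) ∧
      IsReynoldsOperator ρ G R ∧
      ∀ R' : MvPolynomial σ ℂ →ₗ[ℂ] invariants ρ G, IsReynoldsOperator ρ G R' → R' = R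

end Actions

end ClassicalInvariants

/-! Two-sided invariance of Haar measure makes the average over $C$ a projection onto the
$C$-invariants. Passing from $C$ to $G$ is Weyl's unitarian trick: a regular function that vanishes
on $C$ vanishes on $G$ (`IsPolarClosed.eq_zero_of_eq_zero_on_unitary`). By polar decomposition $M =
U e^H$ with $U \in C$ and $H$ Hermitian, and for the classical groups the whole curve $z \mapsto U
e^{zH}$ stays in $G$ (`Family.isPolarClosed_group`). For imaginary $z$ it lies in $C$, so an entire
function of $z$ vanishes there, hence everywhere, hence at $z = 1$.

The principle applies to the coefficients of $g(f) - f$ for $C$-invariant $f$, giving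
$\mathbb{C}[Z]^G = \mathbb{C}[Z]^C$, and to those of $\mathcal{R}(g(f) - f)$, giving
$G$-equivariance. Another Reynolds operator $R'$ commutes with the integral, so $R'(f) =
R'(\mathcal{R}(f)) = \mathcal{R}(f)$.

Vector integrals are handled by testing against real functionals
(`Averageable.vectorIntegral_eq_iff`). Regularity asks only for continuity, which integration needs,
and holomorphy along entire curves, which the trick needs. -/

namespace ClassicalInvariants

/-! ### Maps whose values can be integrated coordinatewise -/

section Averageable

variable {K : Type*} [TopologicalSpace K]

/-- The maps for which `vectorIntegral` is meaningful: the values span a finite-dimensional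
space and every linear functional is continuous along the map. -/
structure Averageable {V : Type*} [AddCommGroup V] [Module ℝ V] (Ψ : K → V) : Prop where
  finite : Module.Finite ℝ (Submodule.span ℝ (Set.range Ψ))
  continuous : ∀ l : V →ₗ[ℝ] ℝ, Continuous fun g => l (Ψ g)

namespace Averageable

variable {V W : Type*} [AddCommGroup V] [Module ℝ V] [AddCommGroup W] [Module ℝ W]
  {Ψ Φ : K → V}

theorem map (hΨ : Averageable Ψ) (T : V →ₗ[ℝ] W) : Averageable fun g => T (Ψ g) where
  finite := by
    have := hΨ.finite
    have : Submodule.span ℝ (Set.range fun g => T (Ψ g)) =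
        (Submodule.span ℝ (Set.range Ψ)).map T := by
      rw [Submodule.map_span, ← Set.range_comp]
      rfl
    rw [this]
    infer_instance
  continuous l := hΨ.continuous (l ∘ₗ T)

theorem add (hΨ : Averageable Ψ) (hΦ : Averageable Φ) : Averageable fun g => Ψ g + Φ g where
  finite := by
    have := hΨ.finite
    have := hΦ.finite
    refine Submodule.finiteDimensional_of_le (S₂ := Submodule.span ℝ (Set.range Ψ) ⊔
      Submodule.span ℝ (Set.range Φ)) (Submodule.span_le.2 ?_)
    rintro _ ⟨g, rfl⟩
    exact Submodule.add_mem_sup (Submodule.subset_span ⟨g, rfl⟩) (Submodule.subset_span ⟨g, rfl⟩)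
  continuous l := by
    simp_rw [map_add]
    exact (hΨ.continuous l).add (hΦ.continuous l)

theorem comp (hΨ : Averageable Ψ) {e : K → K} (he : Continuous e) :
    Averageable fun g => Ψ (e g) where
  finite := by
    have := hΨ.finite
    refine Submodule.finiteDimensional_of_le (S₂ := Submodule.span ℝ (Set.range Ψ))
      (Submodule.span_mono ?_)
    rintro _ ⟨g, rfl⟩
    exact ⟨e g, rfl⟩
  continuous l := (hΨ.continuous l).comp he

theorem const (v : V) : Averageable fun _ : K => v where
  finite := Submodule.finiteDimensional_of_le (S₂ := Submodule.span ℝ {v})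
    (Submodule.span_mono (Set.range_subset_iff.2 fun _ => rfl))
  continuous _ := continuous_const

end Averageable

end Averageable

/-! ### Normalised Haar integration of scalars and vectors -/

section HaarIntegral

variable {K : Type*} [Group K] [TopologicalSpace K] [IsTopologicalGroup K] [CompactSpace K]

theorem isProbabilityMeasure_haarMeasure_top [MeasurableSpace K] [BorelSpace K] :
    IsProbabilityMeasure (Measure.haarMeasure (⊤ : TopologicalSpace.PositiveCompacts K)) :=
  ⟨by simpa using Measure.haarMeasure_self (K₀ := (⊤ : TopologicalSpace.PositiveCompacts K))⟩

theorem haarIntegral_const (c : ℝ) : haarIntegral (fun _ : K => c) = c := by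
  let : MeasurableSpace K := borel K
  have : BorelSpace K := ⟨rfl⟩
  have := isProbabilityMeasure_haarMeasure_top (K := K)
  simp [haarIntegral]

theorem haarIntegral_sum_mul {ι : Type*} (s : Finset ι) (φ : ι → K → ℝ) (c : ι → ℝ)
    (h : ∀ i ∈ s, Continuous (φ i)) :
    haarIntegral (fun g => ∑ i ∈ s, φ i g * c i) = ∑ i ∈ s, haarIntegral (φ i) * c i := by
  let : MeasurableSpace K := borel K
  have : BorelSpace K := ⟨rfl⟩
  unfold haarIntegral
  rw [integral_finsetSum s fun i hi => ((h i hi).integrable_of_hasCompactSupport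
    (HasCompactSupport.of_compactSpace _)).mul_const _]
  simp_rw [integral_mul_const]

theorem haarIntegral_add {φ ψ : K → ℝ} (hφ : Continuous φ) (hψ : Continuous ψ) :
    haarIntegral (fun g => φ g + ψ g) = haarIntegral φ + haarIntegral ψ := by
  let : MeasurableSpace K := borel K
  have : BorelSpace K := ⟨rfl⟩
  exact integral_add (hφ.integrable_of_hasCompactSupport (HasCompactSupport.of_compactSpace _))
    (hψ.integrable_of_hasCompactSupport (HasCompactSupport.of_compactSpace _))

theorem haarIntegral_mul_left (φ : K → ℝ) (h : K) :
    haarIntegral (fun g => φ (h * g)) = haarIntegral φ := by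
  let : MeasurableSpace K := borel K
  have : BorelSpace K := ⟨rfl⟩
  exact integral_mul_left_eq_self φ h

/-- Compact groups are unimodular: a right translate of Haar measure is again a Haar probability
measure, and there is only one. -/
theorem haarIntegral_mul_right (φ : K → ℝ) (h : K) :
    haarIntegral (fun g => φ (g * h)) = haarIntegral φ := by
  let : MeasurableSpace K := borel K
  have : BorelSpace K := ⟨rfl⟩
  have := isProbabilityMeasure_haarMeasure_top (K := K)
  let μ := Measure.haarMeasure (⊤ : TopologicalSpace.PositiveCompacts K)
  have hm : Measurable fun g : K => g * h := (continuous_mul_const h).measurable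
  have : IsProbabilityMeasure (μ.map fun g => g * h) :=
    Measure.isProbabilityMeasure_map hm.aemeasurable
  have hμ : μ.map (fun g => g * h) = μ := Measure.isHaarMeasure_eq_of_isProbabilityMeasure _ _
  have hemb : MeasurableEmbedding fun g : K => g * h :=
    (Homeomorph.mulRight h).measurableEmbedding
  calc haarIntegral (fun g => φ (g * h)) = ∫ x, φ x ∂(μ.map fun g => g * h) :=
        (hemb.integral_map φ).symm
    _ = haarIntegral φ := by rw [hμ]; rfl

namespace Averageable

variable {V W : Type*} [AddCommGroup V] [Module ℝ V] [AddCommGroup W] [Module ℝ W]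
  {Ψ Φ : K → V}

/-- Expanding in the chosen basis reduces this to linearity of a finite sum of scalar integrals; it
removes every dependence on the basis. -/
theorem apply_vectorIntegral (hΨ : Averageable Ψ) (l : V →ₗ[ℝ] ℝ) :
    l (vectorIntegral Ψ) = haarIntegral fun g => l (Ψ g) := by
  classical
  have := hΨ.finite
  let b := Module.Free.chooseBasis ℝ (Submodule.span ℝ (Set.range Ψ))
  let w : K → Submodule.span ℝ (Set.range Ψ) := fun g => ⟨Ψ g, Submodule.subset_span ⟨g, rfl⟩⟩
  -- Coordinates live on the span only; extending them to `V` makes the continuity hypothesis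
  -- applicable.
  have hcont : ∀ i, Continuous fun g => b.repr (w g) i := by
    intro i
    obtain ⟨l', hl'⟩ := LinearMap.exists_extend (b.coord i)
    convert hΨ.continuous l' using 2 with g
    exact (LinearMap.congr_fun hl' (w g)).symm
  have hsum : ∀ g, l (Ψ g) = ∑ i, b.repr (w g) i * l (b i : V) := by
    intro g
    conv_lhs => rw [show Ψ g = ((w g : Submodule.span ℝ (Set.range Ψ)) : V) from rfl,
      ← b.sum_repr (w g)]
    simp only [Submodule.coe_sum, Submodule.coe_smul, map_sum, map_smul, smul_eq_mul]
  simp_rw [hsum]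
  rw [haarIntegral_sum_mul _ _ _ fun i _ => hcont i]
  change l (∑ᶠ i, haarIntegral (fun g => b.repr (w g) i) • (b i : V)) = _
  rw [finsum_eq_sum_of_fintype]
  simp

theorem vectorIntegral_eq_iff (hΨ : Averageable Ψ) (v : V) :
    vectorIntegral Ψ = v ↔ ∀ l : V →ₗ[ℝ] ℝ, (haarIntegral fun g => l (Ψ g)) = l v := by
  refine ⟨fun h l => by rw [← h, hΨ.apply_vectorIntegral], fun h => ?_⟩
  rw [← sub_eq_zero, ← Module.forall_dual_apply_eq_zero_iff ℝ]
  intro l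
  rw [map_sub, hΨ.apply_vectorIntegral, h, sub_self]

theorem vectorIntegral_map (hΨ : Averageable Ψ) (T : V →ₗ[ℝ] W) :
    vectorIntegral (fun g => T (Ψ g)) = T (vectorIntegral Ψ) :=
  ((hΨ.map T).vectorIntegral_eq_iff _).2 fun l => (hΨ.apply_vectorIntegral (l ∘ₗ T)).symm

theorem vectorIntegral_add (hΨ : Averageable Ψ) (hΦ : Averageable Φ) :
    vectorIntegral (fun g => Ψ g + Φ g) = vectorIntegral Ψ + vectorIntegral Φ := by
  refine ((hΨ.add hΦ).vectorIntegral_eq_iff _).2 fun l => ?_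
  simp_rw [map_add]
  rw [haarIntegral_add (hΨ.continuous l) (hΦ.continuous l), hΨ.apply_vectorIntegral,
    hΦ.apply_vectorIntegral]

theorem vectorIntegral_mul_left (hΨ : Averageable Ψ) (h : K) :
    vectorIntegral (fun g => Ψ (h * g)) = vectorIntegral Ψ :=
  ((hΨ.comp (continuous_const_mul h)).vectorIntegral_eq_iff _).2 fun l => by
    rw [hΨ.apply_vectorIntegral, haarIntegral_mul_left (fun g => l (Ψ g)) h]

theorem vectorIntegral_mul_right (hΨ : Averageable Ψ) (h : K) :
    vectorIntegral (fun g => Ψ (g * h)) = vectorIntegral Ψ :=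
  ((hΨ.comp (continuous_mul_const h)).vectorIntegral_eq_iff _).2 fun l => by
    rw [hΨ.apply_vectorIntegral, haarIntegral_mul_right (fun g => l (Ψ g)) h]

theorem vectorIntegral_const (v : V) : vectorIntegral (fun _ : K => v) = v :=
  ((const v).vectorIntegral_eq_iff _).2 fun _ => haarIntegral_const _

end Averageable

end HaarIntegral

/-! ### Regular functions and polynomials with regular coefficients -/

section RegularFamilies

open scoped Pointwise

variable {t : ℕ} {σ : Type*}

/-- A map `ℂ → GL_t(ℂ)` such that the entries of it and of its inverse are entire functions. -/
structure IsEntireCurve (E : ℂ → GL (Fin t) ℂ) : Prop where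
  entry : ∀ i j, Differentiable ℂ fun z => (E z).val i j
  inv_entry : ∀ i j, Differentiable ℂ fun z => (E z)⁻¹.val i j

variable (t) in
/-- The continuous functions on `GL_t(ℂ)` that are entire along every entire curve. -/
def regularFunctions : Subalgebra ℂ (GL (Fin t) ℂ → ℂ) where
  carrier := {p | Continuous p ∧ ∀ E, IsEntireCurve E → Differentiable ℂ fun z => p (E z)}
  mul_mem' hp hq := ⟨hp.1.mul hq.1, fun E hE => (hp.2 E hE).mul (hq.2 E hE)⟩
  add_mem' hp hq := ⟨hp.1.add hq.1, fun E hE => (hp.2 E hE).add (hq.2 E hE)⟩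
  algebraMap_mem' _ := ⟨continuous_const, fun _ _ => differentiable_const _⟩

theorem entry_mem_regularFunctions (i j : Fin t) :
    (fun g : GL (Fin t) ℂ => g.val i j) ∈ regularFunctions t :=
  ⟨Units.continuous_val.matrix_elem i j, fun _ hE => hE.entry i j⟩

theorem inv_entry_mem_regularFunctions (i j : Fin t) :
    (fun g : GL (Fin t) ℂ => g⁻¹.val i j) ∈ regularFunctions t :=
  ⟨(Units.continuous_val.comp continuous_inv).matrix_elem i j, fun _ hE => hE.inv_entry i j⟩

variable (t σ) in
/-- The families of polynomials over `GL_t(ℂ)` with regular coefficients, only finitely many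
of which do not vanish identically. -/
def regularFamilies : Subalgebra ℂ (GL (Fin t) ℂ → MvPolynomial σ ℂ) where
  carrier := {Φ | (∃ s : Finset (σ →₀ ℕ), ∀ g, (Φ g).support ⊆ s) ∧
    ∀ d, (fun g => (Φ g).coeff d) ∈ regularFunctions t}
  mul_mem' := by
    classical
    rintro Φ Ψ ⟨⟨s, hs⟩, hΦ⟩ ⟨⟨u, hu⟩, hΨ⟩
    refine ⟨⟨s + u, fun g => (MvPolynomial.support_mul _ _).trans
      (Finset.add_subset_add (hs g) (hu g))⟩, fun d => ?_⟩
    have : (fun g => ((Φ * Ψ) g).coeff d) = ∑ x ∈ Finset.HasAntidiagonal.antidiagonal d,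
        (fun g => (Φ g).coeff x.1) * fun g => (Ψ g).coeff x.2 := by
      ext g
      simp [MvPolynomial.coeff_mul]
    rw [this]
    exact sum_mem fun x _ => mul_mem (hΦ x.1) (hΨ x.2)
  add_mem' := by
    classical
    rintro Φ Ψ ⟨⟨s, hs⟩, hΦ⟩ ⟨⟨u, hu⟩, hΨ⟩
    refine ⟨⟨s ∪ u, fun g => MvPolynomial.support_add.trans
      (Finset.union_subset_union (hs g) (hu g))⟩, fun d => ?_⟩
    have : (fun g => ((Φ + Ψ) g).coeff d) =
        (fun g => (Φ g).coeff d) + fun g => (Ψ g).coeff d := by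
      ext g
      simp
    rw [this]
    exact add_mem (hΦ d) (hΨ d)
  algebraMap_mem' r := ⟨⟨_, fun _ => subset_rfl⟩, fun d =>
    (regularFunctions t).algebraMap_mem ((MvPolynomial.C r : MvPolynomial σ ℂ).coeff d)⟩

theorem const_mem_regularFamilies (f : MvPolynomial σ ℂ) :
    (fun _ => f) ∈ regularFamilies t σ :=
  ⟨⟨_, fun _ => subset_rfl⟩, fun d => (regularFunctions t).algebraMap_mem (f.coeff d)⟩

theorem C_mem_regularFamilies {p : GL (Fin t) ℂ → ℂ} (hp : p ∈ regularFunctions t) :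
    (fun g => MvPolynomial.C (p g)) ∈ regularFamilies t σ := by
  classical
  refine ⟨⟨{0}, fun g => ?_⟩, fun d => ?_⟩
  · simp only [MvPolynomial.C_apply]
    exact MvPolynomial.support_monomial_subset
  · simp only [MvPolynomial.coeff_C]
    split_ifs
    · exact hp
    · exact zero_mem _

theorem eq_sum_of_support_subset {f : MvPolynomial σ ℂ} {s : Finset (σ →₀ ℕ)}
    (h : f.support ⊆ s) : f = ∑ d ∈ s, f.coeff d • MvPolynomial.monomial d (1 : ℂ) := by
  conv_lhs => rw [f.as_sum]
  rw [Finset.sum_subset h fun d _ hd => by simp [MvPolynomial.notMem_support_iff.1 hd]]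
  simp [MvPolynomial.smul_monomial]

/-- The uniform bound on supports turns `L` into a fixed finite combination of coefficient
functions. -/
theorem apply_mem_regularFunctions {Φ : GL (Fin t) ℂ → MvPolynomial σ ℂ}
    (hΦ : Φ ∈ regularFamilies t σ) (L : MvPolynomial σ ℂ →ₗ[ℂ] ℂ) :
    (fun g => L (Φ g)) ∈ regularFunctions t := by
  obtain ⟨⟨s, hs⟩, hc⟩ := hΦ
  have : (fun g => L (Φ g)) = ∑ d ∈ s, L (MvPolynomial.monomial d 1) •
      fun g => (Φ g).coeff d := by
    ext g
    conv_lhs => rw [eq_sum_of_support_subset (hs g)]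
    simp [mul_comm]
  rw [this]
  exact sum_mem fun d _ => Subalgebra.smul_mem _ (hc d) _

theorem aeval_mem_regularFamilies {τ : Type*} {x : GL (Fin t) ℂ → τ → MvPolynomial σ ℂ}
    (hx : ∀ i, (fun g => x g i) ∈ regularFamilies t σ) (f : MvPolynomial τ ℂ) :
    (fun g => MvPolynomial.aeval (x g) f) ∈ regularFamilies t σ := by
  induction f using MvPolynomial.induction_on with
  | C a =>
    simp only [MvPolynomial.aeval_C]
    exact (regularFamilies t σ).algebraMap_mem a
  | add p q hp hq =>
    simp only [map_add]
    exact add_mem hp hq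
  | mul_X p i hp =>
    simp only [map_mul, MvPolynomial.aeval_X]
    exact mul_mem hp (hx i)

theorem averageable_of_mem_regularFamilies {Φ : GL (Fin t) ℂ → MvPolynomial σ ℂ}
    (hΦ : Φ ∈ regularFamilies t σ) (C : Subgroup (GL (Fin t) ℂ)) :
    Averageable fun g : C => Φ (g : GL (Fin t) ℂ) := by
  obtain ⟨⟨s, hs⟩, hc⟩ := hΦ
  refine ⟨?_, fun l => ?_⟩
  · let W : Submodule ℂ (MvPolynomial σ ℂ) :=
      Submodule.span ℂ ((fun d => MvPolynomial.monomial d (1 : ℂ)) '' (s : Set (σ →₀ ℕ)))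
    have hW : Module.Finite ℂ (W.restrictScalars ℝ) :=
      Module.Finite.span_of_finite ℂ (s.finite_toSet.image fun d => MvPolynomial.monomial d (1 : ℂ))
    have hW' : Module.Finite ℝ (W.restrictScalars ℝ) := Module.Finite.trans ℂ (W.restrictScalars ℝ)
    refine Submodule.finiteDimensional_of_le (S₂ := W.restrictScalars ℝ) (Submodule.span_le.2 ?_)
    rintro _ ⟨g, rfl⟩
    change Φ (g : GL (Fin t) ℂ) ∈ W
    rw [eq_sum_of_support_subset (hs g)]
    exact sum_mem fun d hd => W.smul_mem _ (Submodule.subset_span ⟨d, hd, rfl⟩)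
  -- `l` is only real-linear, so complex coefficients are split into real and imaginary parts.
  · have hl : ∀ (c : ℂ) (v : MvPolynomial σ ℂ),
        l (c • v) = c.re * l v + c.im * l (Complex.I • v) := by
      intro c v
      have h : ∀ (r : ℝ) (w : MvPolynomial σ ℂ), (r : ℂ) • w = r • w := fun r w =>
        IsScalarTower.algebraMap_smul ℂ r w
      conv_lhs => rw [← Complex.re_add_im c, add_smul, mul_smul, h, h]
      simp only [map_add, map_smul, smul_eq_mul]
    have : (fun g : C => l (Φ (g : GL (Fin t) ℂ))) = fun g : C => ∑ d ∈ s,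
        (((Φ g).coeff d).re * l (MvPolynomial.monomial d 1) +
          ((Φ g).coeff d).im * l (Complex.I • MvPolynomial.monomial d 1)) := by
      ext g
      conv_lhs => rw [eq_sum_of_support_subset (hs g)]
      rw [map_sum]
      exact Finset.sum_congr rfl fun d _ => hl _ _
    rw [this]
    refine continuous_finsetSum _ fun d _ => ?_
    have hd : Continuous fun g : C => (Φ g).coeff d := (hc d).1.comp continuous_subtype_val
    exact ((Complex.continuous_re.comp hd).mul continuous_const).add
      ((Complex.continuous_im.comp hd).mul continuous_const)

end RegularFamilies

/-! ### Polar decomposition and the unitarian trick -/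

section Polar

open Matrix
open scoped ComplexOrder

variable {t : ℕ}

/-- The matrix `V exp(z D) V*`, where `D` is the diagonal matrix with entries `a i`. -/
noncomputable def expCurve (V : unitaryGroup (Fin t) ℂ) (a : Fin t → ℝ) (z : ℂ) :
    Matrix (Fin t) (Fin t) ℂ :=
  V.1 * diagonal (fun i => Complex.exp (z * a i)) * (V.1)ᴴ

theorem conjTranspose_mul_unitary (V : unitaryGroup (Fin t) ℂ) : (V.1)ᴴ * V.1 = 1 :=
  mem_unitaryGroup_iff'.1 V.2

theorem unitary_mul_conjTranspose (V : unitaryGroup (Fin t) ℂ) : V.1 * (V.1)ᴴ = 1 :=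
  mem_unitaryGroup_iff.1 V.2

theorem expCurve_zero (V : unitaryGroup (Fin t) ℂ) (a : Fin t → ℝ) : expCurve V a 0 = 1 := by
  simp [expCurve, unitary_mul_conjTranspose]

theorem expCurve_add (V : unitaryGroup (Fin t) ℂ) (a : Fin t → ℝ) (z w : ℂ) :
    expCurve V a (z + w) = expCurve V a z * expCurve V a w := by
  have h : diagonal (fun i => Complex.exp ((z + w) * a i)) =
      diagonal (fun i => Complex.exp (z * a i)) * diagonal fun i => Complex.exp (w * a i) := by
    simp [diagonal_mul_diagonal, add_mul, Complex.exp_add]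
  calc _ = V.1 * diagonal (fun i => Complex.exp (z * a i)) * 1 *
        diagonal (fun i => Complex.exp (w * a i)) * (V.1)ᴴ := by
          rw [expCurve, h, Matrix.mul_one]
          simp only [Matrix.mul_assoc]
    _ = _ := by
      rw [← conjTranspose_mul_unitary V]
      simp only [expCurve, Matrix.mul_assoc]

/-- The exponents `a i` are real, so the adjoint conjugates only the parameter. Hence the curve is
unitary on the imaginary axis. -/
theorem conjTranspose_expCurve (V : unitaryGroup (Fin t) ℂ) (a : Fin t → ℝ) (z : ℂ) :
    (expCurve V a z)ᴴ = expCurve V a (star z) := by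
  simp only [expCurve, conjTranspose_mul, conjTranspose_conjTranspose, diagonal_conjTranspose,
    Matrix.mul_assoc]
  congr 3
  ext i
  simp [← Complex.exp_conj]

/-- `expCurve` as a curve of invertible matrices. -/
noncomputable def expCurveGL (V : unitaryGroup (Fin t) ℂ) (a : Fin t → ℝ) (z : ℂ) :
    GL (Fin t) ℂ where
  val := expCurve V a z
  inv := expCurve V a (-z)
  val_inv := by rw [← expCurve_add, add_neg_cancel, expCurve_zero]
  inv_val := by rw [← expCurve_add, neg_add_cancel, expCurve_zero]

theorem differentiable_expCurve (V : unitaryGroup (Fin t) ℂ) (a : Fin t → ℝ) (i j : Fin t) :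
    Differentiable ℂ fun z => expCurve V a z i j := by
  have h : ∀ z, expCurve V a z i j = ∑ k, V.1 i k * Complex.exp (z * a k) * (V.1)ᴴ k j := by
    intro z
    rw [expCurve, mul_apply]
    simp only [mul_diagonal]
  simp only [h]
  fun_prop

theorem isEntireCurve_mul_expCurveGL (U : GL (Fin t) ℂ) (V : unitaryGroup (Fin t) ℂ)
    (a : Fin t → ℝ) : IsEntireCurve fun z => U * expCurveGL V a z where
  entry i j := by
    change Differentiable ℂ fun z => (U.val * expCurve V a z) i j
    simp only [mul_apply]
    exact Differentiable.fun_sum fun k _ => (differentiable_expCurve V a k j).const_mul _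
  inv_entry i j := by
    have : ∀ z, (U * expCurveGL V a z)⁻¹.val = expCurve V a (-z) * U⁻¹.val := by
      intro z
      rw [_root_.mul_inv_rev]
      rfl
    simp only [this, mul_apply]
    exact Differentiable.fun_sum fun k _ =>
      ((differentiable_expCurve V a i k).comp differentiable_neg).mul_const _

theorem expCurveGL_mem_unitarySubgroup (V : unitaryGroup (Fin t) ℂ) (a : Fin t → ℝ) (s : ℝ) :
    expCurveGL V a (s * Complex.I) ∈ unitarySubgroup t := by
  refine mem_unitaryGroup_iff.2 ?_
  change expCurve V a (s * Complex.I) * (expCurve V a (s * Complex.I))ᴴ = 1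
  rw [conjTranspose_expCurve, ← expCurve_add]
  simp [expCurve_zero]

theorem exists_expCurve_two_eq (M : GL (Fin t) ℂ) :
    ∃ (V : unitaryGroup (Fin t) ℂ) (a : Fin t → ℝ), expCurve V a 2 = M.valᴴ * M.val := by
  have hpos : (M.valᴴ * M.val).PosDef := PosDef.conjTranspose_mul_self _
    (mulVec_injective_iff_isUnit.2 M.isUnit)
  -- Halved logarithms of the eigenvalues make the value at 1 the positive square root of $M^*M$.
  refine ⟨hpos.1.eigenvectorUnitary, fun i => Real.log (hpos.1.eigenvalues i) / 2, ?_⟩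
  conv_rhs => rw [hpos.1.spectral_theorem, Unitary.conjStarAlgAut_apply]
  rw [expCurve]
  congr 3
  ext i
  have : (2 : ℂ) * ((Real.log (hpos.1.eigenvalues i) / 2 : ℝ) : ℂ) =
      (Real.log (hpos.1.eigenvalues i) : ℂ) := by
    push_cast
    ring
  rw [this, ← Complex.ofReal_exp, Real.exp_log (hpos.eigenvalues_pos i)]
  rfl

/-- A subgroup of `GL_t(ℂ)` in which the positive part `(M* M) ^ z` of every element lies. -/
def IsPolarClosed (G : Subgroup (GL (Fin t) ℂ)) : Prop :=
  ∀ M ∈ G, ∀ (V : unitaryGroup (Fin t) ℂ) (a : Fin t → ℝ), expCurve V a 2 = M.valᴴ * M.val →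
    ∀ z, expCurveGL V a z ∈ G

theorem IsPolarClosed.exists_polar {G : Subgroup (GL (Fin t) ℂ)} (hG : IsPolarClosed G)
    {M : GL (Fin t) ℂ} (hM : M ∈ G) :
    ∃ U ∈ G ⊓ unitarySubgroup t, ∃ (V : unitaryGroup (Fin t) ℂ) (a : Fin t → ℝ),
      M = U * expCurveGL V a 1 ∧ ∀ z, expCurveGL V a z ∈ G := by
  obtain ⟨V, a, h⟩ := exists_expCurve_two_eq M
  have hE := hG M hM V a h
  refine ⟨M * (expCurveGL V a 1)⁻¹, ⟨G.mul_mem hM (G.inv_mem (hE 1)), ?_⟩, V, a,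
    by rw [inv_mul_cancel_right], hE⟩
  refine mem_unitaryGroup_iff'.2 ?_
  change (M.val * expCurve V a (-1))ᴴ * (M.val * expCurve V a (-1)) = 1
  calc _ = expCurve V a (-1) * (M.valᴴ * M.val) * expCurve V a (-1) := by
        rw [conjTranspose_mul, conjTranspose_expCurve]
        simp [Matrix.mul_assoc]
    _ = 1 := by
      rw [← h, ← expCurve_add, ← expCurve_add]
      norm_num [expCurve_zero]

theorem det_expCurve (V : unitaryGroup (Fin t) ℂ) (a : Fin t → ℝ) (z : ℂ) :
    (expCurve V a z).det = Complex.exp (z * (∑ i, a i : ℝ)) := by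
  rw [expCurve, det_mul_right_comm, unitary_mul_conjTranspose, Matrix.one_mul, det_diagonal,
    ← Complex.exp_sum]
  simp [Finset.mul_sum]

/-- Since $|\det M|^2 = 1$, the real number $\sum a_i$ is zero, and the determinant is 1 along the
whole curve. -/
theorem isPolarClosed_special : IsPolarClosed (Family.special.group t ℂ) := by
  have hmem : ∀ M : GL (Fin t) ℂ, M ∈ Family.special.group t ℂ ↔ M.val.det = 1 := by
    simp [Family.group, MonoidHom.mem_ker, Units.ext_iff]
  intro M hM V a h z
  rw [hmem] at hM ⊢
  have h1 := congrArg det h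
  rw [det_mul, det_conjTranspose, hM, det_expCurve] at h1
  have h2 : Real.exp (2 * ∑ i, a i) = 1 := by
    have : Complex.exp ((2 * ∑ i, a i : ℝ)) = 1 := by simpa using h1
    exact_mod_cast this
  have h3 : ∑ i, a i = 0 := by
    rw [Real.exp_eq_one_iff] at h2
    linarith
  change (expCurve V a z).det = 1
  rw [det_expCurve, h3]
  simp

/-- In the eigenbasis `V` the curve is diagonal and the form becomes $V^{tr} B V$, so preservation
is checked entry by entry. -/
theorem transpose_expCurve_mul_mul_eq_iff (B : Matrix (Fin t) (Fin t) ℂ)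
    (V : unitaryGroup (Fin t) ℂ) (a : Fin t → ℝ) (z : ℂ) :
    (expCurve V a z)ᵀ * B * expCurve V a z = B ↔
      ∀ i j, Complex.exp (z * a i) * ((V.1)ᵀ * B * V.1) i j * Complex.exp (z * a j) =
        ((V.1)ᵀ * B * V.1) i j := by
  have h1 := conjTranspose_mul_unitary V
  have h2 : (V.1)ᵀ * ((V.1)ᴴ)ᵀ = 1 := by rw [← transpose_mul, h1, transpose_one]
  have h3 := unitary_mul_conjTranspose V
  have h4 : ((V.1)ᴴ)ᵀ * (V.1)ᵀ = 1 := by rw [← transpose_mul, h3, transpose_one]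
  set D : Matrix (Fin t) (Fin t) ℂ := diagonal fun i => Complex.exp (z * a i) with hD
  have key : (expCurve V a z)ᵀ * B * expCurve V a z =
      ((V.1)ᴴ)ᵀ * (D * ((V.1)ᵀ * B * V.1) * D) * (V.1)ᴴ := by
    rw [expCurve, ← hD, transpose_mul, transpose_mul, hD, diagonal_transpose]
    simp only [Matrix.mul_assoc]
  have hentry : (∀ i j, Complex.exp (z * a i) * ((V.1)ᵀ * B * V.1) i j * Complex.exp (z * a j) =
      ((V.1)ᵀ * B * V.1) i j) ↔ D * ((V.1)ᵀ * B * V.1) * D = (V.1)ᵀ * B * V.1 := by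
    rw [← Matrix.ext_iff]
    simp only [hD, mul_diagonal, diagonal_mul]
  rw [hentry, key]
  constructor
  · intro h
    calc _ = ((V.1)ᵀ * ((V.1)ᴴ)ᵀ) * (D * ((V.1)ᵀ * B * V.1) * D) * ((V.1)ᴴ * V.1) := by
          rw [h1, h2, Matrix.one_mul, Matrix.mul_one]
      _ = (V.1)ᵀ * (((V.1)ᴴ)ᵀ * (D * ((V.1)ᵀ * B * V.1) * D) * (V.1)ᴴ) * V.1 := by
          simp only [Matrix.mul_assoc]
      _ = _ := by rw [h]
  · intro h
    calc _ = (((V.1)ᴴ)ᵀ * (V.1)ᵀ) * B * (V.1 * (V.1)ᴴ) := by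
          rw [h]
          simp only [Matrix.mul_assoc]
      _ = B := by rw [h3, h4, Matrix.one_mul, Matrix.mul_one]

/-- For real orthogonal `B` the group is stable under adjoints, so it contains $M^*M$. In an
eigenbasis, each nonzero entry $(i, j)$ of the form then forces $e^{2(a_i + a_j)} = 1$, hence $a_i +
a_j = 0$, a condition that no longer involves the parameter. -/
theorem isPolarClosed_formGroup {B : Matrix (Fin t) (Fin t) ℂ} (hreal : Bᴴ = Bᵀ)
    (horth : Bᵀ * B = 1) : IsPolarClosed (formGroup B) := by
  intro M hM V a h z
  replace hM : M.valᵀ * B * M.val = B := hM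
  -- One-sided inverses of square matrices are two-sided, which gives stability under transposition;
  -- complex conjugation, with `B` real, then gives the adjoint.
  have hM' : M.val * B * M.valᵀ = B := by
    have h1 : M.valᵀ * (B * M.val * Bᵀ) = 1 := by
      rw [← Matrix.mul_assoc, ← Matrix.mul_assoc, hM, mul_eq_one_comm.1 horth]
    have h2 : M.val * Bᵀ * M.valᵀ = Bᵀ :=
      calc _ = Bᵀ * (B * M.val * Bᵀ * M.valᵀ) := by
            rw [show Bᵀ * (B * M.val * Bᵀ * M.valᵀ) = (Bᵀ * B) * (M.val * Bᵀ * M.valᵀ) by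
              simp only [Matrix.mul_assoc], horth, Matrix.one_mul]
        _ = _ := by rw [mul_eq_one_comm.1 h1, Matrix.mul_one]
    simpa [transpose_mul, Matrix.mul_assoc] using congrArg transpose h2
  have hM'' : (M.valᴴ)ᵀ * B * M.valᴴ = B := by
    have h1 := congrArg (fun A => (Aᴴ)ᵀ) hM'
    have hB : (Bᴴ)ᵀ = B := by rw [hreal, transpose_transpose]
    have hMT : ((M.valᵀ)ᴴ)ᵀ = M.valᴴ := by
      ext i j
      simp
    simpa only [conjTranspose_mul, transpose_mul, hB, hMT, Matrix.mul_assoc] using h1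
  have hQ : (expCurve V a 2)ᵀ * B * expCurve V a 2 = B := by
    rw [h, transpose_mul]
    calc _ = M.valᵀ * ((M.valᴴ)ᵀ * B * M.valᴴ) * M.val := by simp only [Matrix.mul_assoc]
      _ = B := by rw [hM'', hM]
  change (expCurve V a z)ᵀ * B * expCurve V a z = B
  rw [transpose_expCurve_mul_mul_eq_iff] at hQ ⊢
  intro i j
  by_cases hij : ((V.1)ᵀ * B * V.1) i j = 0
  · simp [hij]
  · have h1 : Complex.exp (2 * a i) * Complex.exp (2 * a j) = 1 := by
      refine mul_right_cancel₀ hij ?_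
      rw [one_mul]
      conv_rhs => rw [← hQ i j]
      ring
    have h2 : a i + a j = 0 := by
      rw [← Complex.exp_add] at h1
      have h3 : Real.exp (2 * a i + 2 * a j) = 1 := by exact_mod_cast h1
      rw [Real.exp_eq_one_iff] at h3
      linarith
    have h3 : Complex.exp (z * a i) * Complex.exp (z * a j) = 1 := by
      rw [← Complex.exp_add, ← mul_add, ← Complex.ofReal_add, h2]
      simp
    rw [mul_right_comm, h3, one_mul]

theorem conjTranspose_omega (t : ℕ) : (omega t ℂ)ᴴ = (omega t ℂ)ᵀ := by
  ext i j
  simp only [omega, conjTranspose_apply, transpose_apply, of_apply]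
  split_ifs <;> simp

theorem transpose_omega_mul_self (ht : Even t) : (omega t ℂ)ᵀ * omega t ℂ = 1 := by
  obtain ⟨s, rfl⟩ := ht
  have hs : (s + s) / 2 = s := by omega
  ext i j
  simp only [mul_apply, transpose_apply, omega, of_apply, hs, one_apply]
  -- Column `i` of `omega` has a single nonzero entry, in row `i + s` or `i - s`.
  by_cases hi : (i : ℕ) < s
  · have hk : i.val + s < s + s := by omega
    rw [Finset.sum_eq_single ⟨i.val + s, hk⟩]
    · simp only [Fin.ext_iff]
      split_ifs <;> first | omega | simp
    · intro k _ hk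
      simp only [ne_eq, Fin.ext_iff] at hk
      split_ifs <;> first | omega | simp
    · simp
  · have hk : i.val - s < s + s := by omega
    rw [Finset.sum_eq_single ⟨i.val - s, hk⟩]
    · simp only [Fin.ext_iff]
      split_ifs <;> first | omega | simp
    · intro k _ hk
      simp only [ne_eq, Fin.ext_iff] at hk
      split_ifs <;> first | omega | simp
    · simp

theorem Family.isPolarClosed_group (F : Family) (hSp : F = Family.symplectic → Even t) :
    IsPolarClosed (F.group t ℂ) := by
  cases F with
  | general => exact fun _ _ _ _ _ _ => Subgroup.mem_top _
  | special => exact isPolarClosed_special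
  | orthogonal => exact isPolarClosed_formGroup (by simp) (by simp)
  | symplectic =>
    exact isPolarClosed_formGroup (conjTranspose_omega t) (transpose_omega_mul_self (hSp rfl))

/-- A regular function that vanishes on the unitary part of a polar closed group vanishes on
the whole group. -/
theorem IsPolarClosed.eq_zero_of_eq_zero_on_unitary {G : Subgroup (GL (Fin t) ℂ)}
    (hG : IsPolarClosed G) {p : GL (Fin t) ℂ → ℂ} (hp : p ∈ regularFunctions t)
    (h0 : ∀ g ∈ G ⊓ unitarySubgroup t, p g = 0) {M : GL (Fin t) ℂ} (hM : M ∈ G) : p M = 0 := by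
  obtain ⟨U, hU, V, a, rfl, hE⟩ := hG.exists_polar hM
  have hdiff := hp.2 _ (isEntireCurve_mul_expCurveGL U V a)
  have han : AnalyticOnNhd ℂ (fun z => p (U * expCurveGL V a z)) Set.univ :=
    hdiff.differentiableOn.analyticOnNhd isOpen_univ
  have hz : ∀ s : ℝ, p (U * expCurveGL V a (s * Complex.I)) = 0 := fun s =>
    h0 _ (mul_mem hU ⟨hE _, expCurveGL_mem_unitarySubgroup V a s⟩)
  -- Zeros accumulate at 0 along the imaginary axis, as the identity theorem requires.
  have hfreq : ∃ᶠ z in nhdsWithin (0 : ℂ) {0}ᶜ, p (U * expCurveGL V a z) = 0 := by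
    have htend : Filter.Tendsto (fun s : ℝ => (s : ℂ) * Complex.I)
        (nhdsWithin 0 {0}ᶜ) (nhdsWithin 0 {0}ᶜ) := by
      refine tendsto_nhdsWithin_iff.2 ⟨?_, ?_⟩
      · have hc : Continuous fun s : ℝ => (s : ℂ) * Complex.I := by fun_prop
        simpa using (hc.tendsto 0).mono_left nhdsWithin_le_nhds
      · filter_upwards [self_mem_nhdsWithin] with s hs
        simpa using hs
    exact htend.frequently (Filter.Eventually.frequently (Filter.Eventually.of_forall hz))
  exact congrFun (han.eq_of_frequently_eq (g := fun _ => 0) analyticOnNhd_const hfreq) 1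

end Polar

/-! ### The Haar average as Reynolds operator -/

section Reynolds

variable {t : ℕ} {σ : Type*}

/-- An action of `GL_t(ℂ)` from the right by algebra maps, with regular orbit maps. -/
structure IsRegularAction (ρ : GL (Fin t) ℂ → MvPolynomial σ ℂ →ₐ[ℂ] MvPolynomial σ ℂ) :
    Prop where
  regular : ∀ f, (fun g => ρ g f) ∈ regularFamilies t σ
  apply_apply : ∀ g h f, ρ g (ρ h f) = ρ (h * g) f

variable {ρ : GL (Fin t) ℂ → MvPolynomial σ ℂ →ₐ[ℂ] MvPolynomial σ ℂ}

namespace IsRegularAction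

variable (C : Subgroup (GL (Fin t) ℂ))

theorem averageable (hρ : IsRegularAction ρ) (f : MvPolynomial σ ℂ) :
    Averageable fun g : C => ρ (g : GL (Fin t) ℂ) f :=
  averageable_of_mem_regularFamilies (hρ.regular f) C

theorem invariants_eq (hρ : IsRegularAction ρ) {G : Subgroup (GL (Fin t) ℂ)}
    (hG : IsPolarClosed G) :
    invariants ρ G = invariants ρ (G ⊓ unitarySubgroup t) := by
  refine le_antisymm (fun f hf g hg => hf g hg.1) fun f hf g hg => ?_
  rw [← sub_eq_zero]
  ext d
  have hreg : (fun g => ρ g f - f) ∈ regularFamilies t σ :=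
    sub_mem (hρ.regular f) (const_mem_regularFamilies f)
  exact hG.eq_zero_of_eq_zero_on_unitary (hreg.2 d)
    (fun u hu => by simp [show ρ u f = f from hf u hu]) hg

variable [CompactSpace C]

theorem apply_haarAverage (hρ : IsRegularAction ρ) {g : GL (Fin t) ℂ} (hg : g ∈ C)
    (f : MvPolynomial σ ℂ) :
    ρ g (haarAverage ρ C f) = haarAverage ρ C f := by
  have h1 := (hρ.averageable C f).vectorIntegral_map ((ρ g).toLinearMap.restrictScalars ℝ)
  -- Because `ρ` reverses products, acting after averaging translates on the right, and acting
  -- before averaging translates on the left.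
  have h2 := (hρ.averageable C f).vectorIntegral_mul_right ⟨g, hg⟩
  refine h1.symm.trans (Eq.trans ?_ h2)
  exact congrArg vectorIntegral (funext fun u => hρ.apply_apply g u f)

theorem haarAverage_apply (hρ : IsRegularAction ρ) {g : GL (Fin t) ℂ} (hg : g ∈ C)
    (f : MvPolynomial σ ℂ) :
    haarAverage ρ C (ρ g f) = haarAverage ρ C f := by
  refine Eq.trans ?_ ((hρ.averageable C f).vectorIntegral_mul_left ⟨g, hg⟩)
  exact congrArg vectorIntegral (funext fun u => hρ.apply_apply u g f)

/-- The average over a compact group as a linear map to the invariants of that group. -/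
noncomputable def average (hρ : IsRegularAction ρ) : MvPolynomial σ ℂ →ₗ[ℂ] invariants ρ C where
  toFun f := ⟨haarAverage ρ C f, fun _ hg => hρ.apply_haarAverage C hg f⟩
  map_add' f₁ f₂ := Subtype.ext <| by
    refine Eq.trans ?_ ((hρ.averageable C f₁).vectorIntegral_add (hρ.averageable C f₂))
    exact congrArg vectorIntegral (funext fun u => map_add (ρ u) f₁ f₂)
  map_smul' c f := Subtype.ext <| by
    refine Eq.trans ?_ ((hρ.averageable C f).vectorIntegral_map
      ((LinearMap.lsmul ℂ (MvPolynomial σ ℂ) c).restrictScalars ℝ))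
    exact congrArg vectorIntegral (funext fun u => map_smul (ρ u) c f)

theorem haarAverage_of_mem_invariants {f : MvPolynomial σ ℂ} (hf : f ∈ invariants ρ C) :
    haarAverage ρ C f = f := by
  refine Eq.trans ?_ (Averageable.vectorIntegral_const (K := C) f)
  exact congrArg vectorIntegral (funext fun u => hf u u.2)

/-- A linear map that is constant on the orbits of a compact group only depends on averages. -/
theorem apply_haarAverage_eq_of_forall (hρ : IsRegularAction ρ) {V : Type*} [AddCommGroup V] [Module ℂ V]
    (T : MvPolynomial σ ℂ →ₗ[ℂ] V) (hT : ∀ g ∈ C, ∀ f, T (ρ g f) = T f)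
    (f : MvPolynomial σ ℂ) : T (haarAverage ρ C f) = T f := by
  -- The target becomes a real vector space, so that `T` can be moved through the integral.
  let := Module.compHom V (algebraMap ℝ ℂ)
  have : IsScalarTower ℝ ℂ V := IsScalarTower.of_algebraMap_smul fun _ _ => rfl
  have h := (hρ.averageable C f).vectorIntegral_map (T.restrictScalars ℝ)
  refine h.symm.trans (Eq.trans ?_ (Averageable.vectorIntegral_const (K := C) (T f)))
  exact congrArg vectorIntegral (funext fun u => hT u u.2 f)

theorem haarAverageIsReynolds (hρ : IsRegularAction ρ) {G : Subgroup (GL (Fin t) ℂ)} (hG : IsPolarClosed G)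
    (hC : C = G ⊓ unitarySubgroup t) : HaarAverageIsReynolds ρ G C := by
  have hinv : invariants ρ G = invariants ρ C := hC ▸ hρ.invariants_eq hG
  have hCG : C ≤ G := hC ▸ inf_le_left
  let e : invariants ρ C →ₗ[ℂ] invariants ρ G :=
    (Subalgebra.inclusion hinv.ge).toLinearMap
  let R : MvPolynomial σ ℂ →ₗ[ℂ] invariants ρ G := e ∘ₗ hρ.average C
  have hRval : ∀ f, (R f : MvPolynomial σ ℂ) = haarAverage ρ C f := fun _ => rfl
  have hR : IsReynoldsOperator ρ G R := by
    refine ⟨fun f => Subtype.ext (haarAverage_of_mem_invariants C (hinv ▸ f.2)),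
      fun g hg f => ?_⟩
    rw [← sub_eq_zero, ← map_sub]
    ext d
    -- Each coefficient of $\mathcal{R}(g(f) - f)$ is a regular function of $g$ that vanishes on
    -- $C$.
    let L : MvPolynomial σ ℂ →ₗ[ℂ] ℂ :=
      MvPolynomial.lcoeff ℂ d ∘ₗ (invariants ρ G).val.toLinearMap ∘ₗ R
    have hreg : (fun g => ρ g f - f) ∈ regularFamilies t σ :=
      sub_mem (hρ.regular f) (const_mem_regularFamilies f)
    refine hG.eq_zero_of_eq_zero_on_unitary (apply_mem_regularFunctions hreg L) ?_ hg
    intro u hu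
    have hu' : R (ρ u f - f) = 0 := by
      rw [map_sub, sub_eq_zero]
      exact Subtype.ext (hρ.haarAverage_apply C (hC ▸ hu) f)
    simp [L, hu']
  refine ⟨hinv, R, hRval, hR, fun R' hR' => LinearMap.ext fun f => ?_⟩
  rw [← hρ.apply_haarAverage_eq_of_forall C R' (fun g hg => hR'.equivariant g (hCG hg)) f,
    ← hRval, hR'.splits]

end IsRegularAction

/-- Matrix scalars are fixed by algebra maps, so $Y \mapsto hY$ followed by $Y \mapsto gY$ gives
$hgY$, which is the order reversal. -/
theorem isRegularAction_stdAction (t n : ℕ) : IsRegularAction (stdAction (k := ℂ) (t := t) n) where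
  regular f := aeval_mem_regularFamilies (fun p => by
    have : (fun g : GL (Fin t) ℂ => ∑ l : Fin t, MvPolynomial.C (g.val p.1 l) *
        MvPolynomial.X (R := ℂ) (l, p.2)) = ∑ l : Fin t,
        (fun g : GL (Fin t) ℂ => MvPolynomial.C (g.val p.1 l)) *
          fun _ => MvPolynomial.X (R := ℂ) (l, p.2) := by
      ext1 g
      simp
    rw [this]
    exact sum_mem fun l _ => mul_mem (C_mem_regularFamilies (entry_mem_regularFunctions _ _))
      (const_mem_regularFamilies _)) f
  apply_apply g h f := by
    have : (stdAction n g).comp (stdAction n h) = stdAction n (h * g) := by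
      refine MvPolynomial.algHom_ext fun p => ?_
      simp only [AlgHom.comp_apply, stdAction, MvPolynomial.aeval_X, map_sum, map_mul,
        MvPolynomial.algHom_C, MvPolynomial.algebraMap_eq, Units.val_mul, Matrix.mul_apply,
        Finset.sum_mul, Finset.mul_sum]
      rw [Finset.sum_comm]
      simp only [mul_assoc]
    exact DFunLike.congr_fun this f

theorem isRegularAction_stdDualAction (t m n : ℕ) :
    IsRegularAction (stdDualAction (k := ℂ) (t := t) m n) where
  regular f := aeval_mem_regularFamilies (fun p => by
    rcases p with p | p
    · have : (fun g : GL (Fin t) ℂ => ∑ l : Fin t,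
          MvPolynomial.X (R := ℂ) (Sum.inl (p.1, l) : StdDualVars m t n) *
          MvPolynomial.C (g⁻¹.val l p.2)) = ∑ l : Fin t,
          (fun _ => MvPolynomial.X (R := ℂ) (Sum.inl (p.1, l) : StdDualVars m t n)) *
            fun g : GL (Fin t) ℂ => MvPolynomial.C (g⁻¹.val l p.2) := by
        ext1 g
        simp only [Finset.sum_apply, Pi.mul_apply]
      change (fun g : GL (Fin t) ℂ => ∑ l : Fin t,
          MvPolynomial.X (R := ℂ) (Sum.inl (p.1, l) : StdDualVars m t n) *
          MvPolynomial.C (g⁻¹.val l p.2)) ∈ _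
      rw [this]
      exact sum_mem fun l _ => mul_mem (const_mem_regularFamilies _)
        (C_mem_regularFamilies (inv_entry_mem_regularFunctions _ _))
    · have : (fun g : GL (Fin t) ℂ => ∑ l : Fin t, MvPolynomial.C (g.val p.1 l) *
          MvPolynomial.X (R := ℂ) (Sum.inr (l, p.2) : StdDualVars m t n)) = ∑ l : Fin t,
          (fun g : GL (Fin t) ℂ => MvPolynomial.C (g.val p.1 l)) *
            fun _ => MvPolynomial.X (R := ℂ) (Sum.inr (l, p.2) : StdDualVars m t n) := by
        ext1 g
        simp
      change (fun g : GL (Fin t) ℂ => ∑ l : Fin t, MvPolynomial.C (g.val p.1 l) *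
          MvPolynomial.X (R := ℂ) (Sum.inr (l, p.2) : StdDualVars m t n)) ∈ _
      rw [this]
      exact sum_mem fun l _ => mul_mem (C_mem_regularFamilies (entry_mem_regularFunctions _ _))
        (const_mem_regularFamilies _)) f
  apply_apply g h f := by
    have : (stdDualAction m n g).comp (stdDualAction m n h) = stdDualAction m n (h * g) := by
      refine MvPolynomial.algHom_ext fun p => ?_
      rcases p with p | p <;>
      simp only [AlgHom.comp_apply, stdDualAction, MvPolynomial.aeval_X, Sum.elim_inl,
        Sum.elim_inr, map_sum, map_mul, MvPolynomial.algHom_C, MvPolynomial.algebraMap_eq,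
        mul_inv_rev, Units.val_mul, Matrix.mul_apply, Finset.sum_mul, Finset.mul_sum] <;>
      rw [Finset.sum_comm] <;>
      simp only [mul_assoc]
    exact DFunLike.congr_fun this f

end Reynolds

end ClassicalInvariants

theorem proposition6p5 (F : ClassicalInvariants.Family) (t m n : ℕ)
    (ht : 0 < t) (hm : 0 < m) (hn : 0 < n)
    (hSp : F = ClassicalInvariants.Family.symplectic → Even t) :
    ClassicalInvariants.HaarAverageIsReynolds
        (ClassicalInvariants.stdAction (k := ℂ) (t := t) n)
        (F.group t ℂ) (F.compactGroup t) ∧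
      ClassicalInvariants.HaarAverageIsReynolds
        (ClassicalInvariants.stdDualAction (k := ℂ) (t := t) m n)
        (F.group t ℂ) (F.compactGroup t) :=
  ⟨(ClassicalInvariants.isRegularAction_stdAction t n).haarAverageIsReynolds _
      (F.isPolarClosed_group hSp) rfl,
    (ClassicalInvariants.isRegularAction_stdDualAction t m n).haarAverageIsReynolds _
      (F.isPolarClosed_group hSp) rfl⟩
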